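/- **Setting.** Let $AP$ be a set of atomic propositions. A literal is $p$ or $\neg p$ with $p\in AP$; $P,Q,R,S$ denote finite disjunctions of pairwise different literals (treated as sets of literals; the empty disjunction is $0$). An *SNF clause* is an initial clause $P$, a global clause $\mathbf G(P\vee\mathbf X Q)$ (written $\mathbf G(P)$ if its $\mathbf X$ part $Q$ is empty), or an eventuality clause $\mathbf G(P\vee\mathbf F l)$ with eventuality literal $l$. The empty clause $\Box$ is $0$ or $\mathbf G(0)$. A set of SNF clauses is unsatisfiable if no infinite word over $2^{AP}$ satisfies all of its clauses (as LTL formulas) at position $0$. Let $C$ be a finite set of SNF clauses, and for every eventuality literal $l$ of $C$ let $w_l$ be a fresh proposition (not occurring in $C$, and different for different $l$). **Production rules.** There is a main partition $M$ of clauses and one partition $L$ for every iteration of a loop search. The rules are the following; a premise marked $*$ is linked to the conclusion by an edge, the other premises are not. *Saturation* (in $M$): (init-ii) $P\vee l\,{}^*,\ \neg l\vee Q\,{}^*\Rightarrow P\vee Q$; (init-in) $P\vee l\,{}^*,\ \mathbf G(\neg l\vee Q)^*\Rightarrow P\vee Q$; (step-nn) $\mathbf G(P\vee l)^*,\ \mathbf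 G(\neg l\vee Q)^*\Rightarrow\mathbf G(P\vee Q)$; (step-nx) $\mathbf G(P\vee l)^*,\ \mathbf G(Q\vee\mathbf X(\neg l\vee R))^*\Rightarrow\mathbf G(Q\vee\mathbf X(P\vee R))$; (step-xx, also used within a partition $L$) $\mathbf G(P\vee\mathbf X(Q\vee l))^*,\ \mathbf G(R\vee\mathbf X(\neg l\vee S))^*\Rightarrow\mathbf G(P\vee R\vee\mathbf X(Q\vee S))$. *Augmentation* (in $M$): (aug1) $\mathbf G(P\vee\mathbf F l)^*\Rightarrow\mathbf G(P\vee l\vee w_l)$; (aug2) $\mathbf G(P\vee\mathbf F l)\Rightarrow\mathbf G(\neg w_l\vee\mathbf X(l\vee w_l))$. *Loop search for* $\mathbf G(Q\vee\mathbf F l)\in C$: (BFS-loop-it-init-x) $c=\mathbf G(P\vee\mathbf X R)^*$ in $M$ with $R\neq\emptyset$ $\Rightarrow$ $c$ in $L$; (BFS-loop-it-init-n) $\mathbf G(P)^*$ in $M$ $\Rightarrow\mathbf G(\mathbf X P)$ in $L$; (BFS-loop-it-init-c) $\mathbf G(P)$ from the previous iteration and $\mathbf G(Q\vee\mathbf F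 l)$ $\Rightarrow\mathbf G(\mathbf X(P\vee l))$ in $L$; (BFS-loop-it-sub) if $\mathbf G(P)\in L$ subsumes a clause $\mathbf G(R)$ of the previous iteration ($P\subseteq R$), there is an edge from $\mathbf G(P)$ to the clause $\mathbf G(\mathbf X(R\vee l))$ in $L$ (no clause is produced); (BFS-loop-conclusion1) $\mathbf G(P)^*$ in $L$, $\mathbf G(Q\vee\mathbf F l)^*$ in $M$ $\Rightarrow\mathbf G(P\vee Q\vee l)$ in $M$; (BFS-loop-conclusion2) $\mathbf G(P)^*$ in $L$, $\mathbf G(Q\vee\mathbf F l)$ in $M$ $\Rightarrow\mathbf G(\neg w_l\vee\mathbf X(P\vee l))$ in $M$. **Algorithm** (rules are applied in any order). Put $M:=C$; return *unsat* if $\Box\in M$. Saturate $M$ (apply the saturation rules until no new clause is generated), returning *unsat* if $\Box$ is generated. Apply aug1 and aug2 to the eventuality clauses; saturate again, returning *unsat* if $\Box\in M$. Then, until $M$ no longer changes in a full pass (in which case return *sat*), do the following for each eventuality clause $c=\mathbf G(Q\vee\mathbf F l)\in C$. Put $C':=\{\Box\}$ and repeat the following iteration: create a new partition $L$; apply to it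 BFS-loop-it-init-x and BFS-loop-it-init-n for all global clauses in $M$, and BFS-loop-it-init-c for all clauses in $C'$; saturate $L$ under step-xx; say that a loop is *found* if each clause of the old $C'$ is subsumed by a clause $\mathbf G(P)\in L$; replace $C'$ by the set of all clauses of the form $\mathbf G(P)$ in $L$. The iterations end when a loop is found or $C'=\emptyset$. If a loop is found, apply BFS-loop-conclusion1 and BFS-loop-conclusion2 with $c$ to all clauses in $C'$, and saturate $M$, returning *unsat* if $\Box\in M$. **Resolution graph.** During an execution a directed graph $G$ is built. It starts with one vertex in the main partition for each clause in $C$ and no edges. Each rule application that generates a clause that is new in its partition adds a vertex in that partition, labelled with the clause, and edges to it from the vertices of those premises that are marked $*$. The first application of BFS-loop-it-sub to each clause of the old $C'$ in a subsumption test adds the edge described above. **Theorem (Unsatisfiability of the UC in SNF).** Suppose that an execution of the algorithm on $C$ returns *unsat*, let $G$ be the resolution graph built by it, and let $v_\Box$ be a vertex in the main partition of $G$ that is labelled with the empty clause. Let $C^{uc}\subseteq C$ be the set of all $c\in C$ that label a vertex in the main partition of $G$ from which there is a directed path (possibly of length $0$) to $v_\Box$. Then $C^{uc}$ is unsatisfiable.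 -/

import Mathlib

namespace TR

universe u

/-! ### Propositional linear temporal logic -/

/-- LTL formulas over a set `α` of atomic propositions. -/
inductive LTL (α : Type u) : Type u
  | ff : LTL α
  | tt : LTL α
  | atom (p : α) : LTL α
  | not (φ : LTL α) : LTL α
  | or (φ ψ : LTL α) : LTL α
  | and (φ ψ : LTL α) : LTL α
  | next (φ : LTL α) : LTL α
  | until (φ ψ : LTL α) : LTL α
  | releases (φ ψ : LTL α) : LTL α
  | finally (φ : LTL α) : LTL α
  | globally (φ : LTL α) : LTL α

/-- `φ.Sat σ i`: the infinite word `σ` of valuations satisfies `φ` at position `i`. -/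
def LTL.Sat {α : Type u} (σ : ℕ → Set α) : LTL α → ℕ → Prop
  | .ff, _ => False
  | .tt, _ => True
  | .atom p, i => p ∈ σ i
  | .not φ, i => ¬ φ.Sat σ i
  | .or φ ψ, i => φ.Sat σ i ∨ ψ.Sat σ i
  | .and φ ψ, i => φ.Sat σ i ∧ ψ.Sat σ i
  | .next φ, i => φ.Sat σ (i + 1)
  | .until φ ψ, i => ∃ j, i ≤ j ∧ ψ.Sat σ j ∧ ∀ k, i ≤ k → k < j → φ.Sat σ k
  | .releases φ ψ, i => ∀ j, i ≤ j → ψ.Sat σ j ∨ ∃ k, i ≤ k ∧ k < j ∧ φ.Sat σ k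
  | .finally φ, i => ∃ j, i ≤ j ∧ φ.Sat σ j
  | .globally φ, i => ∀ j, i ≤ j → φ.Sat σ j

/-! ### Separated normal form -/

/-- A literal: the proposition `atom` if `sign` is true, its negation otherwise. -/
structure Literal (α : Type u) : Type u where
  atom : α
  sign : Bool
  deriving DecidableEq

/-- The complementary literal. -/
def Literal.neg {α : Type u} (l : Literal α) : Literal α := ⟨l.atom, !l.sign⟩

/-- The positive literal of a proposition. -/
def Literal.pos {α : Type u} (p : α) : Literal α := ⟨p, true⟩

def Literal.toLTL {α : Type u} (l : Literal α) : LTL α :=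
  if l.sign then .atom l.atom else .not (.atom l.atom)

/-- A disjunction of pairwise different literals. -/
abbrev Disj (α : Type u) : Type u := Finset (Literal α)

/-- The disjunction as an LTL formula; the empty disjunction is false. -/
noncomputable def Disj.toLTL {α : Type u} (P : Disj α) : LTL α :=
  ((Finset.toList P).map Literal.toLTL).foldr LTL.or LTL.ff

/-- SNF clauses. `init P` is the initial clause `P`; `global P Q` is `G (P ∨ X Q)`, where
`global P ∅` is `G P`; `ev P l` is the eventuality clause `G (P ∨ F l)`. -/
inductive Clause (α : Type u) : Type u
  | init (P : Disj α) : Clause α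
  | global (P Q : Disj α) : Clause α
  | ev (P : Disj α) (l : Literal α) : Clause α
  deriving DecidableEq

noncomputable def Clause.toLTL {α : Type u} : Clause α → LTL α
  | .init P => Disj.toLTL P
  | .global P Q => .globally (.or (Disj.toLTL P) (.next (Disj.toLTL Q)))
  | .ev P l => .globally (.or (Disj.toLTL P) (.finally l.toLTL))

/-- The empty clause, in one of its two forms `0` and `G 0`. -/
def Clause.IsEmpty {α : Type u} (c : Clause α) : Prop := c = .init ∅ ∨ c = .global ∅ ∅

def Clause.IsEventuality {α : Type u} (c : Clause α) : Prop := ∃ P l, c = .ev P l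

/-- The propositions that occur in a clause. -/
def Clause.atoms {α : Type u} : Clause α → Set α
  | .init P => {p | ∃ l ∈ P, l.atom = p}
  | .global P Q => {p | (∃ l ∈ P, l.atom = p) ∨ ∃ l ∈ Q, l.atom = p}
  | .ev P l => {p | (∃ l' ∈ P, l'.atom = p) ∨ l.atom = p}

/-- A set of SNF clauses is unsatisfiable: no infinite word satisfies (the conjunction of) its
clauses at position 0. -/
def Unsat {α : Type u} (S : Set (Clause α)) : Prop :=
  ¬ ∃ σ : ℕ → Set α, ∀ c ∈ S, c.toLTL.Sat σ 0

/-- `w l` is a fresh proposition for each eventuality literal `l` of `C`: it does not occur in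
`C`, and different eventuality literals get different propositions. -/
structure IsFresh {α : Type u} (C : Finset (Clause α)) (w : Literal α → α) : Prop where
  not_occurs : ∀ P l, Clause.ev P l ∈ C → ∀ c ∈ C, w l ∉ c.atoms
  inj : ∀ P l P' l', Clause.ev P l ∈ C → Clause.ev P' l' ∈ C → w l = w l' → l = l'

/-! ### Resolution graphs -/

/-- The main partition, and one partition for each iteration of a BFS loop search. -/
inductive Part : Type
  | main : Part
  | loop (i : ℕ) : Part

/-- A vertex of a resolution graph. A vertex is only created for a clause that is new in its
partition, so that a vertex is determined by its partition and its label. -/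
structure Vertex (α : Type u) : Type u where
  part : Part
  clause : Clause α

/-- A resolution graph: vertices (with their partition and label), edges `(premise, conclusion)`,
and the number of loop partitions created so far. The clauses in a partition of the algorithm
are the labels of the vertices in that partition. -/
structure ResGraph (α : Type u) : Type u where
  V : Set (Vertex α)
  E : Set (Vertex α × Vertex α)
  loops : ℕ

namespace ResGraph

variable {α : Type u}

/-- One vertex in the main partition per input clause, no edges, no loop partitions. -/
def initial (C : Finset (Clause α)) : ResGraph α where
  V := {v | v.part = .main ∧ v.clause ∈ C}
  E := ∅
  loops := 0

/-- Add the vertex `v`, with edges from the vertices in `S`. -/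
def extend (G : ResGraph α) (S : Set (Vertex α)) (v : Vertex α) : ResGraph α where
  V := insert v G.V
  E := G.E ∪ {e | e.1 ∈ S ∧ e.2 = v}
  loops := G.loops

def addEdge (G : ResGraph α) (u v : Vertex α) : ResGraph α where
  V := G.V
  E := insert (u, v) G.E
  loops := G.loops

/-- Create a new (empty) loop partition; it is the one with number `G.loops`. -/
def newLoop (G : ResGraph α) : ResGraph α where
  V := G.V
  E := G.E
  loops := G.loops + 1

/-- The clauses in the main partition. -/
def mainClauses (G : ResGraph α) : Set (Clause α) := {c | (⟨.main, c⟩ : Vertex α) ∈ G.V}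

/-- The main partition contains the empty clause. -/
def HasEmpty (G : ResGraph α) : Prop := ∃ c ∈ G.mainClauses, c.IsEmpty

/-- The (bodies of the) global clauses with empty `X` part in loop partition `k`. -/
def emptyX (G : ResGraph α) (k : ℕ) : Set (Disj α) :=
  {P | (⟨.loop k, .global P ∅⟩ : Vertex α) ∈ G.V}

/-- `u` is backward reachable from `v`. -/
def BackReach (G : ResGraph α) (v u : Vertex α) : Prop :=
  Relation.ReflTransGen (fun a b => (a, b) ∈ G.E) u v

/-- The unsatisfiable core: the input clauses that label a vertex in the main partition which is
backward reachable from `v` (the vertex of the empty clause). -/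
def core (C : Finset (Clause α)) (G : ResGraph α) (v : Vertex α) : Set (Clause α) :=
  {c | c ∈ C ∧ ∃ u ∈ G.V, G.BackReach v u ∧ u.clause = c ∧ u.part = .main}

end ResGraph

/-! ### Production rules

In each of the following, `R V S v` says that, in a graph with vertex set `V`, an instance of one
of the rules has its premises in `V` and has the conclusion `v`, and that `S` is the set of those
premises from which an edge to the conclusion is drawn. -/

section Rules

variable {α : Type u} [DecidableEq α]

/-- Rule step-xx in the partition `p`. -/
inductive StepXX (p : Part) (V : Set (Vertex α)) : Set (Vertex α) → Vertex α → Prop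
  | step_xx (P Q R S : Disj α) (l : Literal α) (hl : l ∉ Q) (hl' : l.neg ∉ S)
      (h₁ : ⟨p, .global P (insert l Q)⟩ ∈ V) (h₂ : ⟨p, .global R (insert l.neg S)⟩ ∈ V) :
      StepXX p V {⟨p, .global P (insert l Q)⟩, ⟨p, .global R (insert l.neg S)⟩}
        ⟨p, .global (P ∪ R) (Q ∪ S)⟩

/-- The saturation rules in the main partition. -/
inductive Saturation (V : Set (Vertex α)) : Set (Vertex α) → Vertex α → Prop
  | init_ii (P Q : Disj α) (l : Literal α) (hl : l ∉ P) (hl' : l.neg ∉ Q)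
      (h₁ : ⟨.main, .init (insert l P)⟩ ∈ V) (h₂ : ⟨.main, .init (insert l.neg Q)⟩ ∈ V) :
      Saturation V {⟨.main, .init (insert l P)⟩, ⟨.main, .init (insert l.neg Q)⟩}
        ⟨.main, .init (P ∪ Q)⟩
  | init_in (P Q : Disj α) (l : Literal α) (hl : l ∉ P) (hl' : l.neg ∉ Q)
      (h₁ : ⟨.main, .init (insert l P)⟩ ∈ V) (h₂ : ⟨.main, .global (insert l.neg Q) ∅⟩ ∈ V) :
      Saturation V {⟨.main, .init (insert l P)⟩, ⟨.main, .global (insert l.neg Q) ∅⟩}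
        ⟨.main, .init (P ∪ Q)⟩
  | step_nn (P Q : Disj α) (l : Literal α) (hl : l ∉ P) (hl' : l.neg ∉ Q)
      (h₁ : ⟨.main, .global (insert l P) ∅⟩ ∈ V)
      (h₂ : ⟨.main, .global (insert l.neg Q) ∅⟩ ∈ V) :
      Saturation V {⟨.main, .global (insert l P) ∅⟩, ⟨.main, .global (insert l.neg Q) ∅⟩}
        ⟨.main, .global (P ∪ Q) ∅⟩
  | step_nx (P Q R : Disj α) (l : Literal α) (hl : l ∉ P) (hl' : l.neg ∉ R)
      (h₁ : ⟨.main, .global (insert l P) ∅⟩ ∈ V)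
      (h₂ : ⟨.main, .global Q (insert l.neg R)⟩ ∈ V) :
      Saturation V {⟨.main, .global (insert l P) ∅⟩, ⟨.main, .global Q (insert l.neg R)⟩}
        ⟨.main, .global Q (P ∪ R)⟩
  | step_xx (S : Set (Vertex α)) (v : Vertex α) (h : StepXX .main V S v) : Saturation V S v

/-- The augmentation rules; `w l` is the proposition "waiting for `l`". The conclusion of aug2 is
not linked to its premise. -/
inductive Augmentation (w : Literal α → α) (V : Set (Vertex α)) :
    Set (Vertex α) → Vertex α → Prop
  | aug1 (P : Disj α) (l : Literal α) (h : ⟨.main, .ev P l⟩ ∈ V) :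
      Augmentation w V {⟨.main, .ev P l⟩} ⟨.main, .global (P ∪ {l, .pos (w l)}) ∅⟩
  | aug2 (P : Disj α) (l : Literal α) (h : ⟨.main, .ev P l⟩ ∈ V) :
      Augmentation w V ∅ ⟨.main, .global {(Literal.pos (w l)).neg} {l, .pos (w l)}⟩

/-- The rules that initialize loop partition `k` in a search for a loop in `¬ l`, where `prev` is
the set of (bodies of) global clauses with empty `X` part of the previous iteration. The conclusion
of BFS-loop-it-init-c is linked to neither of its premises. -/
inductive LoopInit (l : Literal α) (prev : Set (Disj α)) (k : ℕ) (V : Set (Vertex α)) :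
    Set (Vertex α) → Vertex α → Prop
  | init_x (P Q : Disj α) (hQ : Q.Nonempty) (h : ⟨.main, .global P Q⟩ ∈ V) :
      LoopInit l prev k V {⟨.main, .global P Q⟩} ⟨.loop k, .global P Q⟩
  | init_n (P : Disj α) (h : ⟨.main, .global P ∅⟩ ∈ V) :
      LoopInit l prev k V {⟨.main, .global P ∅⟩} ⟨.loop k, .global ∅ P⟩
  | init_c (P : Disj α) (h : P ∈ prev) :
      LoopInit l prev k V ∅ ⟨.loop k, .global ∅ (insert l P)⟩

/-- The conclusions of a successful search for the eventuality clause `ev Q l`, whose last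
iteration has loop partition `k`. The conclusion of BFS-loop-conclusion2 is not linked to the
eventuality clause. -/
inductive LoopConclusion (w : Literal α → α) (Q : Disj α) (l : Literal α) (k : ℕ)
    (V : Set (Vertex α)) : Set (Vertex α) → Vertex α → Prop
  | conclusion1 (P : Disj α) (h₁ : ⟨.loop k, .global P ∅⟩ ∈ V) (h₂ : ⟨.main, .ev Q l⟩ ∈ V) :
      LoopConclusion w Q l k V {⟨.loop k, .global P ∅⟩, ⟨.main, .ev Q l⟩}
        ⟨.main, .global (P ∪ Q ∪ {l}) ∅⟩
  | conclusion2 (P : Disj α) (h₁ : ⟨.loop k, .global P ∅⟩ ∈ V) (h₂ : ⟨.main, .ev Q l⟩ ∈ V) :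
      LoopConclusion w Q l k V {⟨.loop k, .global P ∅⟩}
        ⟨.main, .global {(Literal.pos (w l)).neg} (P ∪ {l})⟩

end Rules

/-- No instance of the rules `R` generates a new clause. -/
def Exhausted {α : Type u} (R : Set (Vertex α) → Set (Vertex α) → Vertex α → Prop)
    (G : ResGraph α) : Prop :=
  ∀ S v, R G.V S v → v ∈ G.V

/-- An instance of one of the rules `R` generates a new clause in `G`, which leads to `G'`. -/
def Generates {α : Type u} (R : Set (Vertex α) → Set (Vertex α) → Vertex α → Prop)
    (G G' : ResGraph α) : Prop :=
  ∃ S v, R G.V S v ∧ v ∉ G.V ∧ G' = G.extend S v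

/-! ### The algorithm -/

/-- The variables of an iteration of a BFS loop search: `M'` and the eventuality clauses `todo`
that are still to be treated by the enclosing loops, the current eventuality clause `ev Q l`,
the set `prev` of (bodies of) global clauses with empty `X` part of the previous iteration
(`{□}` in the first iteration), and the number `k` of the loop partition. -/
structure Search (α : Type u) : Type u where
  M' : Set (Clause α)
  todo : Set (Clause α)
  Q : Disj α
  l : Literal α
  prev : Set (Disj α)
  k : ℕ

/-- The position of the algorithm. -/
inductive Phase (α : Type u) : Type u
  /-- before the initial test for the empty clause -/
  | start : Phase α
  /-- saturating the main partition; the execution continues with `next` -/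
  | saturate (next : Phase α) : Phase α
  | augment : Phase α
  /-- before the test `M' ≠ M` of the while loop -/
  | whileTest (M' : Set (Clause α)) : Phase α
  /-- in the for loop, with the eventuality clauses `todo` still to be treated -/
  | forEach (M' todo : Set (Clause α)) : Phase α
  | loopInit (s : Search α) : Phase α
  | loopSaturate (s : Search α) : Phase α
  /-- in the subsumption test, where the clauses in `D` have not been found to be subsumed yet -/
  | loopSubsume (s : Search α) (D : Set (Disj α)) : Phase α
  | loopConclude (s : Search α) : Phase α
  | unsat : Phase α
  | sat : Phase α

/-- One step of the algorithm with input `C`, together with the construction of the resolution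
graph. Where the algorithm leaves the order of rule applications open, any order is admitted. -/
inductive Step {α : Type u} [DecidableEq α] (C : Finset (Clause α)) (w : Literal α → α) :
    ResGraph α × Phase α → ResGraph α × Phase α → Prop
  | start_unsat (G) (h : G.HasEmpty) : Step C w (G, .start) (G, .unsat)
  | start_done (G) (h : ¬ G.HasEmpty) : Step C w (G, .start) (G, .saturate .augment)
  | saturate_apply (G G' next) (h : Generates Saturation G G') :
      Step C w (G, .saturate next) (G', .saturate next)
  | saturate_unsat (G next) (h : G.HasEmpty) : Step C w (G, .saturate next) (G, .unsat)
  | saturate_done (G next) (h : Exhausted Saturation G) (h' : ¬ G.HasEmpty) :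
      Step C w (G, .saturate next) (G, next)
  | augment_apply (G G') (h : Generates (Augmentation w) G G') :
      Step C w (G, .augment) (G', .augment)
  | augment_done (G) (h : Exhausted (Augmentation w) G) :
      Step C w (G, .augment) (G, .saturate (.whileTest ∅))
  | while_enter (G M') (h : M' ≠ G.mainClauses) :
      Step C w (G, .whileTest M') (G, .forEach G.mainClauses {c | c ∈ C ∧ c.IsEventuality})
  | while_exit (G M') (h : M' = G.mainClauses) : Step C w (G, .whileTest M') (G, .sat)
  | for_enter (G M' todo Q l) (h : Clause.ev Q l ∈ todo) :
      Step C w (G, .forEach M' todo)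
        (G.newLoop, .loopInit ⟨M', todo \ {.ev Q l}, Q, l, {∅}, G.loops⟩)
  | for_exit (G M') : Step C w (G, .forEach M' ∅) (G, .whileTest M')
  | loopInit_apply (G G' s) (h : Generates (LoopInit s.l s.prev s.k) G G') :
      Step C w (G, .loopInit s) (G', .loopInit s)
  | loopInit_done (G s) (h : Exhausted (LoopInit s.l s.prev s.k) G) :
      Step C w (G, .loopInit s) (G, .loopSaturate s)
  | loopSaturate_apply (G G' s) (h : Generates (StepXX (.loop s.k)) G G') :
      Step C w (G, .loopSaturate s) (G', .loopSaturate s)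
  | loopSaturate_done (G s) (h : Exhausted (StepXX (.loop s.k)) G) :
      Step C w (G, .loopSaturate s) (G, .loopSubsume s s.prev)
  /-- The first application of BFS-loop-it-sub to a clause `G R` of the previous iteration: it is
  subsumed by the clause `G P` of the current iteration. -/
  | subsume_apply (G s) (D) (R P : Disj α) (hR : R ∈ D) (hP : P ∈ G.emptyX s.k) (h : P ⊆ R) :
      Step C w (G, .loopSubsume s D)
        (G.addEdge ⟨.loop s.k, .global P ∅⟩ ⟨.loop s.k, .global ∅ (insert s.l R)⟩,
          .loopSubsume s (D \ {R}))
  /-- A loop has been found: all clauses of the previous iteration are subsumed. -/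
  | subsume_found (G s) : Step C w (G, .loopSubsume s ∅) (G, .loopConclude s)
  /-- No loop has been found, and there is nothing to start another iteration from. -/
  | subsume_fail (G s D) (h : ∃ R ∈ s.prev, ∀ P ∈ G.emptyX s.k, ¬ P ⊆ R)
      (h' : G.emptyX s.k = ∅) :
      Step C w (G, .loopSubsume s D) (G, .forEach s.M' s.todo)
  /-- No loop has been found, and the next iteration is entered. -/
  | subsume_repeat (G s D) (h : ∃ R ∈ s.prev, ∀ P ∈ G.emptyX s.k, ¬ P ⊆ R)
      (h' : G.emptyX s.k ≠ ∅) :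
      Step C w (G, .loopSubsume s D)
        (G.newLoop, .loopInit ⟨s.M', s.todo, s.Q, s.l, G.emptyX s.k, G.loops⟩)
  | conclude_apply (G G' s) (h : Generates (LoopConclusion w s.Q s.l s.k) G G') :
      Step C w (G, .loopConclude s) (G', .loopConclude s)
  | conclude_done (G s) (h : Exhausted (LoopConclusion w s.Q s.l s.k) G) :
      Step C w (G, .loopConclude s) (G, .saturate (.forEach s.M' s.todo))

/-- There is an execution of the algorithm with input `C` that returns "unsat" and constructs the
resolution graph `G`. -/
def ShowsUnsat {α : Type u} [DecidableEq α] (C : Finset (Clause α)) (w : Literal α → α)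
    (G : ResGraph α) : Prop :=
  Relation.ReflTransGen (Step C w) (ResGraph.initial C, .start) (G, .unsat)

end TR

/-!
Let `σ` satisfy the core, and let `τ` agree with `σ` except that `w l` now means that `l` holds at
some strictly later position. Every vertex of the main partition holds in `τ` as soon as the inputs
from which it is reachable do, so the empty clause would hold in `τ`. The premises without an edge
do no harm. The conclusion of aug2, and the contribution of the eventuality clause to
BFS-loop-conclusion2, are true by the meaning of `w l`. The conclusions of BFS-loop-it-init-c are
kept as assumptions: if a clause `G P` of the last iteration fails at `i`, then so does one of the
assumptions `G (X (R ∨ l))` it is reachable from, hence `l` and `R` fail at `i + 1`, and so does the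
clause that subsumes `R`, which is reachable backwards through the edge of BFS-loop-it-sub.
Repeating this, `l` fails at every position after `i`.
-/

namespace TR

variable {α : Type*} {σ τ : ℕ → Set α} {i : ℕ}

namespace Literal

@[simp]
theorem sat_neg {l : Literal α} : l.neg.toLTL.Sat σ i ↔ ¬ l.toLTL.Sat σ i := by
  obtain ⟨p, s⟩ := l
  cases s <;> simp [neg, toLTL, LTL.Sat]

@[simp]
theorem sat_pos {p : α} : (pos p).toLTL.Sat σ i ↔ p ∈ σ i := by
  simp [pos, toLTL, LTL.Sat]

theorem sat_congr {l : Literal α} (h : l.atom ∈ σ i ↔ l.atom ∈ τ i) :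
    l.toLTL.Sat σ i ↔ l.toLTL.Sat τ i := by
  obtain ⟨p, s⟩ := l
  cases s <;> simpa [toLTL, LTL.Sat, not_iff_not] using h

end Literal

namespace Disj

theorem sat_iff_exists {P : Disj α} : P.toLTL.Sat σ i ↔ ∃ l ∈ P, l.toLTL.Sat σ i := by
  have sat_foldr (L : List (Literal α)) :
      ((L.map Literal.toLTL).foldr LTL.or LTL.ff).Sat σ i ↔ ∃ l ∈ L, l.toLTL.Sat σ i := by
    induction L with
    | nil => simp [LTL.Sat]
    | cons a L ih => simp [LTL.Sat, ih]
  simpa [toLTL] using sat_foldr P.toList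

@[simp]
theorem not_sat_empty : ¬ (toLTL (∅ : Disj α)).Sat σ i := by
  simp [sat_iff_exists]

@[simp]
theorem sat_singleton {l : Literal α} : (toLTL {l}).Sat σ i ↔ l.toLTL.Sat σ i := by
  simp [sat_iff_exists]

theorem sat_mono {P Q : Disj α} (hPQ : P ⊆ Q) (h : P.toLTL.Sat σ i) : Q.toLTL.Sat σ i := by
  obtain ⟨l, hl, hsat⟩ := sat_iff_exists.1 h
  exact sat_iff_exists.2 ⟨l, hPQ hl, hsat⟩

theorem sat_congr {P : Disj α} (h : ∀ l ∈ P, (l.atom ∈ σ i ↔ l.atom ∈ τ i)) :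
    P.toLTL.Sat σ i ↔ P.toLTL.Sat τ i := by
  simp only [sat_iff_exists]
  exact exists_congr fun l => and_congr_right fun hl => Literal.sat_congr (h l hl)

variable [DecidableEq α] {P Q : Disj α} {l : Literal α}

@[simp]
theorem sat_insert : (toLTL (insert l P)).Sat σ i ↔ l.toLTL.Sat σ i ∨ P.toLTL.Sat σ i := by
  simp [sat_iff_exists]

@[simp]
theorem sat_union : (toLTL (P ∪ Q)).Sat σ i ↔ P.toLTL.Sat σ i ∨ Q.toLTL.Sat σ i := by
  simp [sat_iff_exists, or_and_right, exists_or]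

theorem sat_resolvent (h₁ : (toLTL (insert l P)).Sat σ i)
    (h₂ : (toLTL (insert l.neg Q)).Sat σ i) : (toLTL (P ∪ Q)).Sat σ i := by
  simp only [sat_insert, Literal.sat_neg] at h₁ h₂
  rw [sat_union]
  tauto

end Disj

namespace Clause

/-- The truth of the instance at position `i` of a global clause. No other clauses occur in loop
partitions, so that the value on them does not matter. -/
def StepSat (τ : ℕ → Set α) (i : ℕ) : Clause α → Prop
  | .global P Q => P.toLTL.Sat τ i ∨ Q.toLTL.Sat τ (i + 1)
  | _ => True

/-- What the clauses `G P` of the last iteration of a successful loop search for `l` stand for: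
`G (P ∨ X G ¬ l)`, that is, `¬ P` is part of a loop in `¬ l`. There is no condition on other
clauses. -/
def LoopSat (τ : ℕ → Set α) (l : Literal α) (c : Clause α) : Prop :=
  ∀ P, c = .global P ∅ → ∀ i, P.toLTL.Sat τ i ∨ ∀ j, i < j → ¬ l.toLTL.Sat τ j

theorem sat_init {P : Disj α} : (init P).toLTL.Sat σ 0 ↔ P.toLTL.Sat σ 0 :=
  Iff.rfl

theorem sat_global {P Q : Disj α} :
    (global P Q).toLTL.Sat σ 0 ↔ ∀ i, (global P Q).StepSat σ i := by
  simp [toLTL, LTL.Sat, StepSat]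

theorem sat_global_empty {P : Disj α} :
    (global P ∅).toLTL.Sat σ 0 ↔ ∀ i, P.toLTL.Sat σ i := by
  simp [sat_global, StepSat]

theorem sat_ev {P : Disj α} {l : Literal α} :
    (ev P l).toLTL.Sat σ 0 ↔ ∀ i, P.toLTL.Sat σ i ∨ ∃ j, i ≤ j ∧ l.toLTL.Sat σ j := by
  simp [toLTL, LTL.Sat]

theorem IsEmpty.not_sat {c : Clause α} (h : c.IsEmpty) : ¬ c.toLTL.Sat σ 0 := by
  rcases h with rfl | rfl
  · exact Disj.not_sat_empty
  · simp [sat_global_empty]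

theorem sat_congr {c : Clause α} (h : ∀ i, ∀ p ∈ c.atoms, (p ∈ σ i ↔ p ∈ τ i)) :
    c.toLTL.Sat σ 0 ↔ c.toLTL.Sat τ 0 := by
  cases c with
  | init P => exact Disj.sat_congr fun l hl => h 0 _ ⟨l, hl, rfl⟩
  | global P Q =>
    simp only [sat_global, StepSat]
    exact forall_congr' fun i => or_congr
      (Disj.sat_congr fun l hl => h i _ (.inl ⟨l, hl, rfl⟩))
      (Disj.sat_congr fun l hl => h (i + 1) _ (.inr ⟨l, hl, rfl⟩))
  | ev P l =>
    simp only [sat_ev]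
    exact forall_congr' fun i => or_congr
      (Disj.sat_congr fun l hl => h i _ (.inl ⟨l, hl, rfl⟩))
      (exists_congr fun j => and_congr_right fun _ => Literal.sat_congr (h j _ (.inr rfl)))

theorem stepSat_resolvent [DecidableEq α] {P Q R S : Disj α} {l : Literal α}
    (h₁ : (global P (insert l Q)).StepSat τ i) (h₂ : (global R (insert l.neg S)).StepSat τ i) :
    (global (P ∪ R) (Q ∪ S)).StepSat τ i := by
  rcases h₁ with hP | hQ
  · exact .inl (Disj.sat_union.2 (.inl hP))
  rcases h₂ with hR | hS
  · exact .inl (Disj.sat_union.2 (.inr hR))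
  · exact .inr (Disj.sat_resolvent hQ hS)

end Clause

/-! ### The meaning of the fresh propositions -/

/-- In `τ`, each proposition `w l` means that the eventuality literal `l` of `C` holds at some
strictly later position. -/
def WaitsFor (C : Finset (Clause α)) (w : Literal α → α) (τ : ℕ → Set α) : Prop :=
  ∀ P l, Clause.ev P l ∈ C → ∀ i, w l ∈ τ i ↔ ∃ j, i < j ∧ l.toLTL.Sat τ j

theorem exists_le_iff_or_exists_lt {q : ℕ → Prop} :
    (∃ j, i ≤ j ∧ q j) ↔ q i ∨ ∃ j, i < j ∧ q j := by
  simp only [Nat.le_iff_lt_or_eq]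
  grind

namespace WaitsFor

variable {C : Finset (Clause α)} {w : Literal α → α} {Q : Disj α} {l : Literal α}

theorem exists_le_iff (hw : WaitsFor C w τ) (hl : .ev Q l ∈ C) :
    (∃ j, i ≤ j ∧ l.toLTL.Sat τ j) ↔ l.toLTL.Sat τ i ∨ w l ∈ τ i := by
  rw [exists_le_iff_or_exists_lt, hw Q l hl]

theorem mem_iff_succ (hw : WaitsFor C w τ) (hl : .ev Q l ∈ C) :
    w l ∈ τ i ↔ l.toLTL.Sat τ (i + 1) ∨ w l ∈ τ (i + 1) := by
  rw [hw Q l hl, ← hw.exists_le_iff hl]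
  rfl

end WaitsFor

theorem IsFresh.exists_waitsFor {C : Finset (Clause α)} {w : Literal α → α} (hw : IsFresh C w)
    (σ : ℕ → Set α) :
    ∃ τ, WaitsFor C w τ ∧ ∀ c ∈ C, (c.toLTL.Sat σ 0 ↔ c.toLTL.Sat τ 0) := by
  let τ : ℕ → Set α := fun i =>
    {p | ((∀ P l, .ev P l ∈ C → w l ≠ p) ∧ p ∈ σ i) ∨
      ∃ P l, .ev P l ∈ C ∧ w l = p ∧ ∃ j, i < j ∧ l.toLTL.Sat σ j}
  have mem_congr (c) (hc : c ∈ C) (i) (p) (hp : p ∈ c.atoms) : p ∈ σ i ↔ p ∈ τ i := by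
    have hfresh (P l) (h : Clause.ev P l ∈ C) : w l ≠ p := by
      rintro rfl
      exact hw.not_occurs P l h c hc hp
    constructor
    · exact fun hpσ => .inl ⟨hfresh, hpσ⟩
    · rintro (⟨-, hpσ⟩ | ⟨P, l, h, hwl, -⟩)
      · exact hpσ
      · exact absurd hwl (hfresh P l h)
  refine ⟨τ, fun P l h i => ?_, fun c hc => Clause.sat_congr (mem_congr c hc)⟩
  have sat_iff (j) : l.toLTL.Sat σ j ↔ l.toLTL.Sat τ j :=
    Literal.sat_congr (mem_congr _ h j _ (.inr rfl))
  simp only [← sat_iff]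
  constructor
  · rintro (⟨hne, -⟩ | ⟨P', l', h', hwl, hlater⟩)
    · exact absurd rfl (hne P l h)
    · rwa [← hw.inj P' l' P l h' h hwl]
  · exact fun hlater => .inr ⟨P, l, h, rfl, hlater⟩

/-! ### Soundness of resolution graphs -/

namespace ResGraph

variable {A A' T T' : Vertex α → Prop} {G G' : ResGraph α} {S : Set (Vertex α)} {u v : Vertex α}

/-- The axioms (the vertices satisfying `A`) from which `v` is reachable are all true (satisfy
`T`). -/
def Grounded (G : ResGraph α) (A T : Vertex α → Prop) (v : Vertex α) : Prop :=
  ∀ u ∈ G.V, A u → G.BackReach v u → T u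

/-- The vertices of `G` are consequences, for the truth predicate `T`, of the axioms (the vertices
satisfying `A`) from which they are reachable. -/
def IsSound (G : ResGraph α) (A T : Vertex α → Prop) : Prop :=
  ∀ v ∈ G.V, G.Grounded A T v → T v

theorem BackReach.mono (hE : G.E ⊆ G'.E) (h : G.BackReach v u) : G'.BackReach v u :=
  Relation.ReflTransGen.mono (fun _ _ hab => hE hab) _ _ h

theorem Grounded.of_backReach (h : G.Grounded A T v) (hu : G.BackReach v u) :
    G.Grounded A T u :=
  fun x hx hA hxu => h x hx hA (hxu.trans hu)

theorem Grounded.anti (hV : G.V ⊆ G'.V) (hE : G.E ⊆ G'.E) (h : G'.Grounded A T v) :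
    G.Grounded A T v :=
  fun u hu hA huv => h u (hV hu) hA (huv.mono hE)

theorem IsSound.mono (hG : G.IsSound A T) (hA : ∀ u, A u → A' u ∧ (T' u → T u))
    (hT : ∀ v ∈ G.V, T v → T' v) : G.IsSound A' T' :=
  fun v hv hgr => hT v hv <| hG v hv fun u hu hAu huv =>
    (hA u hAu).2 (hgr u hu (hA u hAu).1 huv)

theorem IsSound.addEdge (hG : G.IsSound A T) (a b : Vertex α) : (G.addEdge a b).IsSound A T :=
  fun v hv hgr => hG v hv (hgr.anti (G' := G.addEdge a b) subset_rfl (Set.subset_insert _ _))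

theorem IsSound.extend (hG : G.IsSound A T) (hS : S ⊆ G.V) (hv : (∀ u ∈ S, T u) → A v ∨ T v) :
    (G.extend S v).IsSound A T := by
  have hV : G.V ⊆ (G.extend S v).V := Set.subset_insert _ _
  have hE : G.E ⊆ (G.extend S v).E := Set.subset_union_left
  rintro x (rfl | hx) hgr
  · have premise_true (u) (hu : u ∈ S) : T u :=
      hG u (hS hu) ((hgr.of_backReach (.single (.inr ⟨hu, rfl⟩))).anti hV hE)
    exact (hv premise_true).elim (fun hA => hgr x (.inl rfl) hA .refl) id
  · exact hG x hx (hgr.anti hV hE)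

theorem IsSound.generates {R : Set (Vertex α) → Set (Vertex α) → Vertex α → Prop}
    (hG : G.IsSound A T) (hgen : Generates R G G') (hprem : ∀ S v, R G.V S v → S ⊆ G.V)
    (hR : ∀ S v, R G.V S v → (∀ u ∈ S, T u) → A v ∨ T v) : G'.IsSound A T := by
  obtain ⟨S, v, h, -, rfl⟩ := hgen
  exact hG.extend (hprem S v h) (hR S v h)

end ResGraph

/-- Truth of a vertex in `τ`: satisfaction of the clause in the main partition, and the
predicate `T k` in loop partition `k`. -/
def Vertex.TrueIn (τ : ℕ → Set α) (T : ℕ → Clause α → Prop) : Vertex α → Prop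
  | ⟨.main, c⟩ => c.toLTL.Sat τ 0
  | ⟨.loop k, c⟩ => T k c

/-- The vertices that a run on `C` with `n` loop partitions may contain: the only eventuality
clauses are those of `C`, and the loop partitions are numbered below `n`. -/
def Vertex.Admissible (C : Finset (Clause α)) (n : ℕ) : Vertex α → Prop
  | ⟨.main, c⟩ => c.IsEventuality → c ∈ C
  | ⟨.loop k, _⟩ => k < n

/-- The vertices of the input clauses `C`. -/
def IsInput (C : Finset (Clause α)) (v : Vertex α) : Prop :=
  v.part = .main ∧ v.clause ∈ C

theorem IsInput.trueIn_iff {C : Finset (Clause α)} {v : Vertex α} {T T' : ℕ → Clause α → Prop}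
    (h : IsInput C v) : v.TrueIn τ T ↔ v.TrueIn τ T' := by
  obtain ⟨_, c⟩ := v
  obtain ⟨rfl, -⟩ := h
  rfl

/-- The possible conclusions of BFS-loop-it-init-c in an iteration `s` of a loop search. -/
def Search.IsAssumption [DecidableEq α] (s : Search α) (v : Vertex α) : Prop :=
  ∃ R ∈ s.prev, v = ⟨.loop s.k, .global ∅ (insert s.l R)⟩

/-- Truth in `τ` during an iteration `s` of a loop search, with the clauses in its loop partition
taken at position `i` only. -/
def Search.StepTrue (τ : ℕ → Set α) (s : Search α) (i : ℕ) : Vertex α → Prop :=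
  Vertex.TrueIn τ fun k c => k = s.k → c.StepSat τ i

/-- Truth in `τ` after the iteration `s` has found a loop. -/
def Search.LoopTrue (τ : ℕ → Set α) (s : Search α) : Vertex α → Prop :=
  Vertex.TrueIn τ fun k c => k = s.k → c.LoopSat τ s.l

/-! ### Soundness of the production rules -/

section Rules

variable [DecidableEq α] {C : Finset (Clause α)} {w : Literal α → α} {p : Part} {k n : ℕ}
  {l : Literal α} {Q : Disj α} {prev : Set (Disj α)} {V S : Set (Vertex α)} {v : Vertex α}
  {T : ℕ → Clause α → Prop}

namespace Saturation

theorem premises_subset (h : Saturation V S v) : S ⊆ V := by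
  cases h with
  | step_xx _ _ h => cases h; grind
  | _ => grind

theorem admissible (h : Saturation V S v) : v.Admissible C n := by
  cases h with
  | step_xx _ _ h => cases h; rintro ⟨_, _, ⟨⟩⟩
  | _ => rintro ⟨_, _, ⟨⟩⟩

theorem trueIn (h : Saturation V S v) (hS : ∀ u ∈ S, u.TrueIn τ T) : v.TrueIn τ T := by
  cases h with
  | init_ii P Q l =>
    have h₁ := Clause.sat_init.1 (hS _ (.inl rfl))
    have h₂ := Clause.sat_init.1 (hS _ (.inr rfl))
    exact Clause.sat_init.2 (Disj.sat_resolvent h₁ h₂)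
  | init_in P Q l =>
    have h₁ := Clause.sat_init.1 (hS _ (.inl rfl))
    have h₂ := Clause.sat_global_empty.1 (hS _ (.inr rfl))
    exact Clause.sat_init.2 (Disj.sat_resolvent h₁ (h₂ 0))
  | step_nn P Q l =>
    have h₁ := Clause.sat_global_empty.1 (hS _ (.inl rfl))
    have h₂ := Clause.sat_global_empty.1 (hS _ (.inr rfl))
    exact Clause.sat_global_empty.2 fun i => Disj.sat_resolvent (h₁ i) (h₂ i)
  | step_nx P Q R l =>
    have h₁ := Clause.sat_global_empty.1 (hS _ (.inl rfl))
    have h₂ := Clause.sat_global.1 (hS _ (.inr rfl))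
    exact Clause.sat_global.2 fun i => (h₂ i).imp_right (Disj.sat_resolvent (h₁ (i + 1)))
  | step_xx _ _ h =>
    cases h with
    | step_xx P Q R S l =>
      have h₁ := Clause.sat_global.1 (hS _ (.inl rfl))
      have h₂ := Clause.sat_global.1 (hS _ (.inr rfl))
      exact Clause.sat_global.2 fun i => Clause.stepSat_resolvent (h₁ i) (h₂ i)

end Saturation

namespace Augmentation

theorem premises_subset (h : Augmentation w V S v) : S ⊆ V := by
  cases h <;> grind

theorem admissible (h : Augmentation w V S v) : v.Admissible C n := by
  cases h <;> rintro ⟨_, _, ⟨⟩⟩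

theorem trueIn (h : Augmentation w V S v) (hw : WaitsFor C w τ)
    (hV : ∀ u ∈ V, u.Admissible C n) (hS : ∀ u ∈ S, u.TrueIn τ T) : v.TrueIn τ T := by
  cases h with
  | aug1 P l h =>
    have hl : .ev P l ∈ C := hV _ h ⟨P, l, rfl⟩
    have hP := Clause.sat_ev.1 (hS _ rfl)
    refine Clause.sat_global_empty.2 fun i => ?_
    simpa only [Disj.sat_union, Disj.sat_insert, Disj.sat_singleton, Literal.sat_pos,
      hw.exists_le_iff hl] using hP i
  | aug2 P l h =>
    have hl : .ev P l ∈ C := hV _ h ⟨P, l, rfl⟩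
    refine Clause.sat_global.2 fun i => ?_
    simp only [Clause.StepSat, Disj.sat_insert, Disj.sat_singleton, Literal.sat_neg,
      Literal.sat_pos, ← hw.mem_iff_succ hl]
    exact (em _).symm

end Augmentation

namespace LoopConclusion

theorem premises_subset (h : LoopConclusion w Q l k V S v) : S ⊆ V := by
  cases h <;> grind

theorem admissible (h : LoopConclusion w Q l k V S v) : v.Admissible C n := by
  cases h <;> rintro ⟨_, _, ⟨⟩⟩

theorem trueIn (h : LoopConclusion w Q l k V S v) (hw : WaitsFor C w τ)
    (hV : ∀ u ∈ V, u.Admissible C n) (hT : ∀ c, T k c → c.LoopSat τ l)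
    (hS : ∀ u ∈ S, u.TrueIn τ T) : v.TrueIn τ T := by
  cases h with
  | conclusion1 P h₁ h₂ =>
    have hP := hT _ (hS _ (.inl rfl)) P rfl
    have hQ := Clause.sat_ev.1 (hS _ (.inr rfl))
    simp only [exists_le_iff_or_exists_lt] at hQ
    refine Clause.sat_global_empty.2 fun i => ?_
    simp only [Disj.sat_union, Disj.sat_singleton]
    grind
  | conclusion2 P h₁ h₂ =>
    have hl : .ev Q l ∈ C := hV _ h₂ ⟨Q, l, rfl⟩
    have hP := hT _ (hS _ rfl) P rfl
    refine Clause.sat_global.2 fun i => ?_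
    have hwait := hw.mem_iff_succ hl (i := i)
    rw [hw Q l hl (i + 1)] at hwait
    simp only [Clause.StepSat, Disj.sat_union, Disj.sat_singleton, Literal.sat_neg,
      Literal.sat_pos]
    grind

end LoopConclusion

namespace LoopInit

variable {s : Search α}

theorem premises_subset (h : LoopInit l prev k V S v) : S ⊆ V := by
  cases h <;> grind

theorem admissible (h : LoopInit l prev k V S v) (hk : k < n) : v.Admissible C n := by
  cases h <;> exact hk

theorem trueIn_top (h : LoopInit l prev k V S v) : v.TrueIn τ ⊤ := by
  cases h <;> trivial

theorem isAssumption_or_stepTrue (h : LoopInit s.l s.prev s.k V S v)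
    (hS : ∀ u ∈ S, s.StepTrue τ i u) : s.IsAssumption v ∨ s.StepTrue τ i v := by
  cases h with
  | init_x P Q => exact .inr fun _ => Clause.sat_global.1 (hS _ rfl) i
  | init_n P => exact .inr fun _ => .inr (Clause.sat_global_empty.1 (hS _ rfl) (i + 1))
  | init_c P h => exact .inl ⟨P, h, rfl⟩

end LoopInit

namespace StepXX

variable {s : Search α}

theorem premises_subset (h : StepXX p V S v) : S ⊆ V := by
  cases h
  grind

theorem admissible (h : StepXX (.loop k) V S v) (hk : k < n) : v.Admissible C n := by
  cases h
  exact hk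

theorem trueIn_top (h : StepXX (.loop k) V S v) : v.TrueIn τ ⊤ := by
  cases h
  trivial

theorem stepTrue (h : StepXX (.loop s.k) V S v) (hS : ∀ u ∈ S, s.StepTrue τ i u) :
    s.StepTrue τ i v := by
  cases h with
  | step_xx P Q R S l =>
    exact fun _ => Clause.stepSat_resolvent (hS _ (.inl rfl) rfl) (hS _ (.inr rfl) rfl)

end StepXX

end Rules

/-! ### Invariants of an execution -/

section Invariants

variable {C : Finset (Clause α)} {w : Literal α → α} {G G' : ResGraph α} {s : Search α}
  {R : Set (Vertex α) → Set (Vertex α) → Vertex α → Prop}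

theorem Generates.loops_eq (h : Generates R G G') : G'.loops = G.loops := by
  obtain ⟨S, v, -, -, rfl⟩ := h
  rfl

/-- The invariant of the resolution graph: all vertices are admissible, and the main partition is
sound. The truth predicate `⊤` imposes nothing on the loop partitions, which are only sound during
the search they belong to. -/
structure GraphInv (C : Finset (Clause α)) (τ : ℕ → Set α) (G : ResGraph α) : Prop where
  admissible : ∀ v ∈ G.V, v.Admissible C G.loops
  sound : G.IsSound (IsInput C) (Vertex.TrueIn τ ⊤)

namespace GraphInv

theorem sat_of_sat_core (hG : GraphInv C τ G) {c : Clause α}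
    (hc : ⟨.main, c⟩ ∈ G.V) (hcore : ∀ d ∈ G.core C ⟨.main, c⟩, d.toLTL.Sat τ 0) :
    c.toLTL.Sat τ 0 := by
  refine hG.sound _ hc ?_
  rintro ⟨_, d⟩ hd ⟨rfl, hdC⟩ hreach
  exact hcore d ⟨hdC, _, hd, hreach, rfl, rfl⟩

theorem initial : GraphInv C τ (.initial C) where
  admissible := by
    rintro ⟨_, c⟩ ⟨rfl, hc⟩ -
    exact hc
  sound v hv hgr := hgr v hv hv .refl

theorem newLoop (hG : GraphInv C τ G) : GraphInv C τ G.newLoop where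
  admissible
    | ⟨.main, _⟩, hv => hG.admissible _ hv
    | ⟨.loop _, _⟩, hv => Nat.lt_succ_of_lt (hG.admissible _ hv)
  sound := hG.sound

theorem addEdge (hG : GraphInv C τ G) (a b : Vertex α) : GraphInv C τ (G.addEdge a b) :=
  ⟨hG.admissible, hG.sound.addEdge a b⟩

theorem admissible_generates (hG : GraphInv C τ G) (hgen : Generates R G G')
    (hadm : ∀ S v, R G.V S v → v.Admissible C G.loops) :
    ∀ v ∈ G'.V, v.Admissible C G'.loops := by
  obtain ⟨S, v, h, -, rfl⟩ := hgen
  exact Set.forall_mem_insert.2 ⟨hadm S v h, hG.admissible⟩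

theorem saturation [DecidableEq α] (hG : GraphInv C τ G) (h : Generates Saturation G G') :
    GraphInv C τ G' where
  admissible := hG.admissible_generates h fun _ _ hr => hr.admissible
  sound := hG.sound.generates h (fun _ _ hr => hr.premises_subset)
    fun _ _ hr hS => .inr (hr.trueIn hS)

theorem augmentation [DecidableEq α] (hG : GraphInv C τ G) (hw : WaitsFor C w τ)
    (h : Generates (Augmentation w) G G') : GraphInv C τ G' where
  admissible := hG.admissible_generates h fun _ _ hr => hr.admissible
  sound := hG.sound.generates h (fun _ _ hr => hr.premises_subset)
    fun _ _ hr hS => .inr (hr.trueIn hw hG.admissible hS)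

theorem loopInit [DecidableEq α] (hG : GraphInv C τ G) (hk : s.k < G.loops)
    (h : Generates (LoopInit s.l s.prev s.k) G G') : GraphInv C τ G' where
  admissible := hG.admissible_generates h fun _ _ hr => hr.admissible hk
  sound := hG.sound.generates h (fun _ _ hr => hr.premises_subset)
    fun _ _ hr _ => .inr hr.trueIn_top

theorem loopSaturate [DecidableEq α] (hG : GraphInv C τ G) (hk : s.k < G.loops)
    (h : Generates (StepXX (.loop s.k)) G G') : GraphInv C τ G' where
  admissible := hG.admissible_generates h fun _ _ hr => hr.admissible hk
  sound := hG.sound.generates h (fun _ _ hr => hr.premises_subset)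
    fun _ _ hr _ => .inr hr.trueIn_top

end GraphInv

/-- A loop has been found by the iteration `s`, and the clauses of its loop partition are sound in
the sense of `Clause.LoopSat`. -/
def LoopSound (C : Finset (Clause α)) (τ : ℕ → Set α) (s : Search α) (G : ResGraph α) : Prop :=
  G.IsSound (IsInput C) (s.LoopTrue τ)

theorem LoopSound.conclusion [DecidableEq α] (hs : LoopSound C τ s G) (hG : GraphInv C τ G)
    (hw : WaitsFor C w τ) (h : Generates (LoopConclusion w s.Q s.l s.k) G G') :
    LoopSound C τ s G' :=
  hs.generates h (fun _ _ hr => hr.premises_subset)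
    fun _ _ hr hS => .inr (hr.trueIn hw hG.admissible (fun _ hc => hc rfl) hS)

theorem LoopSound.trueIn_top (hs : LoopSound C τ s G) :
    G.IsSound (IsInput C) (Vertex.TrueIn τ ⊤) :=
  hs.mono (fun _ hu => ⟨hu, hu.trueIn_iff.1⟩) fun
    | ⟨.main, _⟩, _, h => h
    | ⟨.loop _, _⟩, _, _ => trivial

theorem GraphInv.conclusion [DecidableEq α] (hG : GraphInv C τ G) (hs : LoopSound C τ s G)
    (hw : WaitsFor C w τ) (h : Generates (LoopConclusion w s.Q s.l s.k) G G') :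
    GraphInv C τ G' where
  admissible := hG.admissible_generates h fun _ _ hr => hr.admissible
  sound := (hs.conclusion hG hw h).trueIn_top

variable [DecidableEq α]

/-- At every position, the clauses in the loop partition of `s` follow from the input clauses and
the assumptions of `s` from which they are reachable. -/
def StepSound (C : Finset (Clause α)) (τ : ℕ → Set α) (s : Search α) (G : ResGraph α) : Prop :=
  ∀ i, G.IsSound (fun v => IsInput C v ∨ s.IsAssumption v) (s.StepTrue τ i)

/-- Each clause of the previous iteration outside `D` is subsumed by a clause of the current one,
with an edge from BFS-loop-it-sub. -/
def Subsumed (s : Search α) (D : Set (Disj α)) (G : ResGraph α) : Prop :=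
  ∀ R ∈ s.prev, R ∉ D → ∃ P ∈ G.emptyX s.k, P ⊆ R ∧
    (⟨.loop s.k, .global P ∅⟩, ⟨.loop s.k, .global ∅ (insert s.l R)⟩) ∈ G.E

theorem GraphInv.stepSound_newLoop (hG : GraphInv C τ G) (hs : s.k = G.loops) :
    StepSound C τ s G.newLoop :=
  fun _ => hG.newLoop.sound.mono (fun _ hu => ⟨.inl hu, hu.trueIn_iff.1⟩) fun
    | ⟨.main, _⟩, _, h => h
    | ⟨.loop _, _⟩, hv, _ => fun hk => absurd (hG.admissible _ hv) (hk.trans hs).not_lt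

theorem StepSound.loopInit (hs : StepSound C τ s G)
    (h : Generates (LoopInit s.l s.prev s.k) G G') : StepSound C τ s G' :=
  fun i => (hs i).generates h (fun _ _ hr => hr.premises_subset)
    fun _ _ hr hS => (hr.isAssumption_or_stepTrue hS).imp_left .inr

theorem StepSound.loopSaturate (hs : StepSound C τ s G)
    (h : Generates (StepXX (.loop s.k)) G G') : StepSound C τ s G' :=
  fun i => (hs i).generates h (fun _ _ hr => hr.premises_subset)
    fun _ _ hr hS => .inr (hr.stepTrue hS)

theorem Subsumed.addEdge {D : Set (Disj α)} {P R : Disj α} (h : Subsumed s D G)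
    (hP : P ∈ G.emptyX s.k) (hPR : P ⊆ R) :
    Subsumed s (D \ {R})
      (G.addEdge ⟨.loop s.k, .global P ∅⟩ ⟨.loop s.k, .global ∅ (insert s.l R)⟩) := by
  intro R' hR' hD
  rcases eq_or_ne R' R with rfl | hne
  · exact ⟨P, hP, hPR, Set.mem_insert _ _⟩
  · obtain ⟨P', hP', hsub, hE⟩ := h R' hR' fun hmem => hD ⟨hmem, hne⟩
    exact ⟨P', hP', hsub, Set.mem_insert_of_mem _ hE⟩

theorem StepSound.exists_assumption_not_sat (hs : StepSound C τ s G) {P : Disj α}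
    (hP : P ∈ G.emptyX s.k)
    (hgr : G.Grounded (IsInput C) (s.LoopTrue τ) ⟨.loop s.k, .global P ∅⟩)
    (hi : ¬ P.toLTL.Sat τ i) :
    ∃ R ∈ s.prev,
      G.BackReach ⟨.loop s.k, .global P ∅⟩ ⟨.loop s.k, .global ∅ (insert s.l R)⟩ ∧
      ¬ s.l.toLTL.Sat τ (i + 1) ∧ ¬ R.toLTL.Sat τ (i + 1) := by
  by_contra! hsat
  have hP_step : (Clause.global P ∅).StepSat τ i := by
    refine hs i _ hP ?_ rfl
    rintro u hu (hin | ⟨R, hR, rfl⟩) hreach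
    · exact hin.trueIn_iff.1 (hgr u hu hin hreach)
    · exact fun _ => .inr (Disj.sat_insert.2 (or_iff_not_imp_left.2 (hsat R hR hreach)))
  exact hP_step.elim hi Disj.not_sat_empty

theorem StepSound.not_sat_add (hs : StepSound C τ s G) (hsub : Subsumed s ∅ G) (d : ℕ)
    {P : Disj α} (hP : P ∈ G.emptyX s.k)
    (hgr : G.Grounded (IsInput C) (s.LoopTrue τ) ⟨.loop s.k, .global P ∅⟩)
    (hi : ¬ P.toLTL.Sat τ i) : ¬ s.l.toLTL.Sat τ (i + 1 + d) := by
  induction d generalizing i P with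
  | zero =>
    obtain ⟨_, -, -, hl, -⟩ := hs.exists_assumption_not_sat hP hgr hi
    exact hl
  | succ d ih =>
    obtain ⟨R, hR, hreach, -, hRsat⟩ := hs.exists_assumption_not_sat hP hgr hi
    obtain ⟨P', hP', hP'R, hE⟩ := hsub R hR (Set.notMem_empty R)
    rw [← add_assoc, add_right_comm]
    exact ih hP' (hgr.of_backReach (.head hE hreach)) (mt (Disj.sat_mono hP'R) hRsat)

theorem StepSound.loopSound (hs : StepSound C τ s G) (hG : GraphInv C τ G)
    (hsub : Subsumed s ∅ G) : LoopSound C τ s G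
  | ⟨.main, _⟩, hv, hgr =>
    hG.sound _ hv fun u hu hin hreach => hin.trueIn_iff.1 (hgr u hu hin hreach)
  | ⟨.loop _, _⟩, hv, hgr => by
    rintro rfl P rfl i
    refine or_iff_not_imp_left.2 fun hi j hij => ?_
    obtain ⟨d, rfl⟩ := Nat.exists_eq_add_of_le (Nat.succ_le_of_lt hij)
    exact hs.not_sat_add hsub d hv hgr hi

/-- The invariant of the resolution graph in the given phase of the algorithm. Saturation of the
main partition may be followed only by phases whose invariant does not depend on the graph. -/
def PhaseInv (C : Finset (Clause α)) (τ : ℕ → Set α) : Phase α → ResGraph α → Prop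
  | .saturate next, _ => ∀ G, PhaseInv C τ next G
  | .loopInit s, G => s.k < G.loops ∧ StepSound C τ s G
  | .loopSaturate s, G => s.k < G.loops ∧ StepSound C τ s G
  | .loopSubsume s D, G => s.k < G.loops ∧ StepSound C τ s G ∧ Subsumed s D G
  | .loopConclude s, G => LoopSound C τ s G
  | _, _ => True

theorem Step.invariant {x y : ResGraph α × Phase α} (h : Step C w x y) (hw : WaitsFor C w τ)
    (hG : GraphInv C τ x.1) (hp : PhaseInv C τ x.2 x.1) :
    GraphInv C τ y.1 ∧ PhaseInv C τ y.2 y.1 := by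
  cases h with
  | start_unsat => exact ⟨hG, trivial⟩
  | start_done => exact ⟨hG, fun _ => trivial⟩
  | saturate_apply _ _ _ h => exact ⟨hG.saturation h, hp⟩
  | saturate_unsat => exact ⟨hG, trivial⟩
  | saturate_done => exact ⟨hG, hp _⟩
  | augment_apply _ _ h => exact ⟨hG.augmentation hw h, trivial⟩
  | augment_done => exact ⟨hG, fun _ => trivial⟩
  | while_enter => exact ⟨hG, trivial⟩
  | while_exit => exact ⟨hG, trivial⟩
  | for_enter => exact ⟨hG.newLoop, Nat.lt_succ_self _, hG.stepSound_newLoop rfl⟩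
  | for_exit => exact ⟨hG, trivial⟩
  | loopInit_apply _ _ _ h =>
    exact ⟨hG.loopInit hp.1 h, h.loops_eq ▸ hp.1, hp.2.loopInit h⟩
  | loopInit_done => exact ⟨hG, hp⟩
  | loopSaturate_apply _ _ _ h =>
    exact ⟨hG.loopSaturate hp.1 h, h.loops_eq ▸ hp.1, hp.2.loopSaturate h⟩
  | loopSaturate_done => exact ⟨hG, hp.1, hp.2, fun R hR hR' => absurd hR hR'⟩
  | subsume_apply _ _ _ _ _ _ hP h =>
    exact ⟨hG.addEdge _ _, hp.1, fun i => (hp.2.1 i).addEdge _ _, hp.2.2.addEdge hP h⟩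
  | subsume_found => exact ⟨hG, hp.2.1.loopSound hG hp.2.2⟩
  | subsume_fail => exact ⟨hG, trivial⟩
  | subsume_repeat => exact ⟨hG.newLoop, Nat.lt_succ_self _, hG.stepSound_newLoop rfl⟩
  | conclude_apply _ _ _ h => exact ⟨hG.conclusion hp hw h, hp.conclusion hG hw h⟩
  | conclude_done => exact ⟨hG, fun _ => trivial⟩

theorem GraphInv.of_reachable {x : ResGraph α × Phase α} (hw : WaitsFor C w τ)
    (hx : Relation.ReflTransGen (Step C w) (.initial C, .start) x) : GraphInv C τ x.1 := by
  suffices GraphInv C τ x.1 ∧ PhaseInv C τ x.2 x.1 from this.1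
  induction hx with
  | refl => exact ⟨.initial, trivial⟩
  | tail _ hstep ih => exact hstep.invariant hw ih.1 ih.2

end Invariants

end TR

theorem mainTheorem1 {AP : Type*} [DecidableEq AP] (C : Finset (TR.Clause AP))
    (w : TR.Literal AP → AP) (hw : TR.IsFresh C w)
    (G : TR.ResGraph AP) (hG : TR.ShowsUnsat C w G)
    (v : TR.Vertex AP) (hv : v ∈ G.V) (hmain : v.part = TR.Part.main)
    (hempty : v.clause.IsEmpty) :
    TR.Unsat (TR.ResGraph.core C G v) := by
  rintro ⟨σ, hσ⟩
  obtain ⟨τ, hτ, sat_iff⟩ := hw.exists_waitsFor σ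
  obtain ⟨_, c⟩ := v
  obtain rfl : _ = TR.Part.main := hmain
  have hcore (d) (hd : d ∈ G.core C ⟨.main, c⟩) : d.toLTL.Sat τ 0 := (sat_iff d hd.1).1 (hσ d hd)
  exact hempty.not_sat ((TR.GraphInv.of_reachable hτ hG).sat_of_sat_core hv hcore)
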